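/- **Notation.** Let $C_N^B=\{x\in\mathbb R^N: x_1\ge x_2\ge\dots\ge x_N\ge 0\}$ and let $(B_t)_{t\ge 0}$ be a standard $N$-dimensional Brownian motion with $B_0=0$. For $k_1,k_2>0$, a *Bessel process of type $B_N$ with multiplicity $k=(k_1,k_2)$ started at $x_0$* is a continuous $C_N^B$-valued process with $$dX^i_t=dB^i_t+k_2\sum_{j\ne i}\Bigl(\frac1{X^i_t-X^j_t}+\frac1{X^i_t+X^j_t}\Bigr)dt+\frac{k_1}{X^i_t}\,dt\quad(i=1,\dots,N),\qquad X_0=x_0,$$ where the drift is a.s. locally integrable in time (so that a.s. $X_t$ is in the interior of $C_N^B$ for Lebesgue-almost all $t$). For $\nu>0$ and $x$ in the interior of $C_N^B$, let $\phi(t,x)$, $t\ge0$, be the solution in the interior of $C_N^B$ of $$\dot\phi_i=\sum_{j\ne i}\Bigl(\frac1{\phi_i-\phi_j}+\frac1{\phi_i+\phi_j}\Bigr)+\frac{\nu}{\phi_i}\quad(i=1,\dots,N),\qquad \phi(0,x)=x .$$ Let $A_\nu(t,x)\in\mathbb R^{N\times N}$ be the matrix with entries, at $\phi=\phi(t,x)$,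 $$A_\nu(t,x)_{i,j}=\frac1{(\phi_i-\phi_j)^2}-\frac1{(\phi_i+\phi_j)^2}\ (i\neq j),\qquad A_\nu(t,x)_{i,i}=-\sum_{j\ne i}\Bigl(\frac1{(\phi_i-\phi_j)^2}+\frac1{(\phi_i+\phi_j)^2}\Bigr)-\frac{\nu}{\phi_i^2}.$$ **Theorem 3.2.** Let $\nu>0$, let $x$ be a point in the interior of $C_N^B$ and let $y\in\mathbb R^N$. Let $\beta_0\ge\frac12$ be such that $\sqrt\beta\,x+y$ is in the interior of $C_N^B$ for all $\beta\ge\beta_0$. For $\beta\ge\beta_0$ let $(X_{t,\beta})_{t\ge0}$ be a Bessel process of type $B_N$ with $k=(\nu\beta,\beta)$ started at $\sqrt\beta\,x+y$, all driven by the same Brownian motion $B$. Let $(W_t)_{t\ge0}$ be the continuous solution of $$dW_t=dB_t+A_\nu(t,x)W_t\,dt,\qquad W_0=y .$$ Then $W$ is a Gaussian process, and the following holds. 1. For every $t>0$ there is a finite random variable $C$, not depending on $\beta$, such that for every $\beta\ge\beta_0$, almost surely, $$\sqrt\beta\,\|X_{s,\beta}-\sqrt\beta\,\phi(s,x)-W_s\|\le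 C\qquad\text{for all } s\in[0,t].$$ 2. If the processes $X_{\cdot,\beta}$ solve their equations simultaneously for all $\beta\ge\beta_0$ outside one null set, then for every $t>0$ $$\sup_{0\le s\le t,\ \beta\ge\beta_0}\sqrt\beta\,\|X_{s,\beta}-\sqrt\beta\,\phi(s,x)-W_s\|<\infty\quad\text{a.s.},$$ and, a.s., for every $t>0$, $X_{s,\beta}-\sqrt\beta\,\phi(s,x)\to W_s$ as $\beta\to\infty$ uniformly in $s\in[0,t]$, with rate $O(1/\sqrt\beta)$. -/

import Mathlib

open MeasureTheory ProbabilityTheory Filter Topology Set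
open scoped NNReal

noncomputable section

/-- The closed Weyl chamber `{x ∈ ℝ^N : x₁ ≥ x₂ ≥ … ≥ x_N ≥ 0}` of type `B_N`. -/
def weylChamberB (N : ℕ) : Set (EuclideanSpace ℝ (Fin N)) :=
  {x | (∀ i j : Fin N, i ≤ j → x j ≤ x i) ∧ ∀ i : Fin N, 0 ≤ x i}

/-- The vector field `½ ∇ ln w_k` for the multiplicity `k = (k₁, k₂)` of type `B_N`; its `i`-th
coordinate is `k₂ ∑_{j ≠ i} (1 / (x_i - x_j) + 1 / (x_i + x_j)) + k₁ / x_i`. It is only evaluated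
at points of the interior of the chamber, where no denominator vanishes. -/
def besselDriftB {N : ℕ} (k₁ k₂ : ℝ) (x : EuclideanSpace ℝ (Fin N)) :
    EuclideanSpace ℝ (Fin N) :=
  WithLp.toLp 2 fun i =>
    k₂ * ∑ j ∈ Finset.univ.erase i, (1 / (x i - x j) + 1 / (x i + x j)) + k₁ / x i

/-- `B` is a standard `N`-dimensional Brownian motion (started at `0`): its coordinates are
independent one-dimensional Brownian motions. Time is real, and only times `t ≥ 0` matter. -/
structure IsBrownianMotion {N : ℕ} {Ω : Type*} [MeasurableSpace Ω]
    (B : ℝ → Ω → EuclideanSpace ℝ (Fin N)) (P : Measure Ω) : Prop where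
  isBrownianReal : ∀ i : Fin N, IsBrownianReal (fun (t : ℝ≥0) ω => B t ω i) P
  indep : iIndepFun (fun (i : Fin N) ω => fun t : ℝ≥0 => B t ω i) P

/-- The path `p` solves, along the driving path `b` and with starting point `p₀`, the equation
`dp = db + ½ (∇ ln w_k)(p) dt` of the Bessel process of type `B_N` with `k = (k₁, k₂)`: it is
continuous, stays in the closed chamber, and satisfies the integrated equation with a locally
integrable drift. (The noise is additive, so the stochastic integral `∫₀ᵗ dB` is just `B_t`.)
As the drift is infinite on the boundary of the chamber, its integrability includes that the time
which the path spends on the boundary has Lebesgue measure zero; this is `ae_mem_interior`. -/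
structure IsBesselPathB {N : ℕ} (k₁ k₂ : ℝ) (p₀ : EuclideanSpace ℝ (Fin N))
    (b p : ℝ → EuclideanSpace ℝ (Fin N)) : Prop where
  continuousOn : ContinuousOn p (Ici 0)
  mem_chamber : ∀ t, 0 ≤ t → p t ∈ weylChamberB N
  ae_mem_interior : ∀ᵐ s ∂(volume.restrict (Ici (0 : ℝ))), p s ∈ interior (weylChamberB N)
  intervalIntegrable : ∀ t, 0 ≤ t →
    IntervalIntegrable (fun s => besselDriftB k₁ k₂ (p s)) volume 0 t
  eq_integral : ∀ t, 0 ≤ t → p t = p₀ + b t + ∫ s in (0 : ℝ)..t, besselDriftB k₁ k₂ (p s)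

/-- `φ` is the solution in the interior of the chamber, for times `t ≥ 0`, of the deterministic
limit equation `φ' = H(φ)`, `φ(0) = x`, where `H` is the drift for `k = (ν, 1)`. -/
structure IsLimitFlowB {N : ℕ} (ν : ℝ) (x : EuclideanSpace ℝ (Fin N))
    (φ : ℝ → EuclideanSpace ℝ (Fin N)) : Prop where
  initial : φ 0 = x
  mem_interior : ∀ t, 0 ≤ t → φ t ∈ interior (weylChamberB N)
  hasDerivWithinAt : ∀ t, 0 ≤ t → HasDerivWithinAt φ (besselDriftB ν 1 (φ t)) (Ici 0) t

/-- The matrix `A_ν`, evaluated at the point `q` (to be used with `q = φ(t, x)`). -/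
def limitMatrixB {N : ℕ} (ν : ℝ) (q : EuclideanSpace ℝ (Fin N)) : Matrix (Fin N) (Fin N) ℝ :=
  Matrix.of fun i j =>
    if i = j then
      ∑ l ∈ Finset.univ.erase i, (-1 / (q i - q l) ^ 2 - 1 / (q i + q l) ^ 2) - ν / q i ^ 2
    else 1 / (q i - q j) ^ 2 - 1 / (q i + q j) ^ 2

/-- The path `w` solves, along the driving path `b` and with starting point `w₀`, the linear
equation `dw = db + A_ν(t, x) w dt`, where `A_ν(t, x) = limitMatrixB ν (φ t)`. -/
structure IsLimitPathB {N : ℕ} (ν : ℝ) (φ : ℝ → EuclideanSpace ℝ (Fin N))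
    (w₀ : EuclideanSpace ℝ (Fin N)) (b w : ℝ → EuclideanSpace ℝ (Fin N)) : Prop where
  continuousOn : ContinuousOn w (Ici 0)
  eq_integral : ∀ t, 0 ≤ t →
    w t = w₀ + b t + ∫ s in (0 : ℝ)..t, WithLp.toLp 2 ((limitMatrixB ν (φ s)).mulVec (w s))

end

/-! Write `H` for the drift with `k = (ν, 1)`. The estimate is pathwise: the noise is additive, so
it cancels in `D = X - (√β φ + W)`, and `D` solves an integral equation without noise.

Three facts about `H` control `D`. It is the gradient of a concave function, hence monotone
(`inner_besselDriftB_sub_nonpos`); it is homogeneous of degree `-1`; and its derivative is `A_ν`,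
with a quadratic Taylor remainder that is uniform away from the walls. With `z = √β φ + W`, the
velocity of `D` is `β (H(X) - H(z))`, which never pushes `D` outwards, plus the consistency error `β
H(z) - √β H(φ) - A_ν W`. By homogeneity the latter is `√β` times a Taylor remainder with increment
`W / √β`, hence `O(1/√β)`. Integrating `‖D‖²` bounds `D` by the same order, however close `X` comes
to the walls.

This needs `z` inside the chamber, which holds once `√β` exceeds a threshold `l` depending on the
path. Below it, `X` is compared with `l φ + W` instead, and crude bounds suffice because `β` is
bounded. Every constant depends on the path only through a bound of `‖B‖` on `[0, t]`
(`exists_scaled_error_bound`), which gives a random variable independent of `β`.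

`W` is Gaussian because it is the limit of Euler schemes, each an affine function of finitely many
values of `B`, and almost sure limits of Gaussian vectors are Gaussian. -/

/-- All coordinate gaps of `q`, and the last coordinate, are at least `c`. -/
def GapGE {N : ℕ} (c : ℝ) (q : EuclideanSpace ℝ (Fin N)) : Prop :=
  (∀ i j : Fin N, i < j → c ≤ q i - q j) ∧ ∀ i : Fin N, c ≤ q i

/-! ### Quantitative distance to the walls of the chamber -/

section Chamber

variable {N : ℕ} {c : ℝ} {q h : EuclideanSpace ℝ (Fin N)}

lemma GapGE.abs_sub (hq : GapGE c q) {i j : Fin N} (hij : i ≠ j) : c ≤ |q i - q j| := by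
  rcases lt_or_gt_of_ne hij with h | h
  · exact (hq.1 i j h).trans (le_abs_self _)
  · rw [abs_sub_comm]; exact (hq.1 j i h).trans (le_abs_self _)

lemma GapGE.abs_add (hc : 0 ≤ c) (hq : GapGE c q) (i j : Fin N) : c ≤ |q i + q j| := by
  have h1 := hq.2 i
  have h2 := hq.2 j
  exact (by linarith : c ≤ q i + q j).trans (le_abs_self _)

lemma GapGE.abs_self (hq : GapGE c q) (i : Fin N) : c ≤ |q i| :=
  (hq.2 i).trans (le_abs_self _)

lemma abs_apply_le_norm (v : EuclideanSpace ℝ (Fin N)) (i : Fin N) : |v i| ≤ ‖v‖ := by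
  simpa using PiLp.norm_apply_le v i

/-- Each coordinate moves by at most `c / 4`, so a difference of two moves by at most `c / 2`. -/
lemma GapGE.add (hq : GapGE c q) (hh : ‖h‖ ≤ c / 4) : GapGE (c / 2) (q + h) := by
  have hi : ∀ i, |h i| ≤ c / 4 := fun i => (abs_apply_le_norm h i).trans hh
  refine ⟨fun i j hij => ?_, fun i => ?_⟩
  · have := hq.1 i j hij
    have h1 := abs_le.1 (hi i)
    have h2 := abs_le.1 (hi j)
    simp only [PiLp.add_apply]
    linarith [h1.1, h2.2]
  · have := hq.2 i
    have h1 := abs_le.1 (hi i)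
    have h0 := (abs_nonneg _).trans (hi i)
    simp only [PiLp.add_apply]
    linarith [h1.1]

lemma GapGE.mem_weylChamberB (hc : 0 ≤ c) (hq : GapGE c q) : q ∈ weylChamberB N := by
  refine ⟨fun i j hij => ?_, fun i => hc.trans (hq.2 i)⟩
  rcases hij.lt_or_eq with h | rfl
  · linarith [hq.1 i j h]
  · exact le_rfl

lemma GapGE.mem_interior (hc : 0 < c) (hq : GapGE c q) : q ∈ interior (weylChamberB N) := by
  rw [mem_interior_iff_mem_nhds, Metric.mem_nhds_iff]
  refine ⟨c / 4, by positivity, fun z hz => ?_⟩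
  have : GapGE (c / 2) (q + (z - q)) := hq.add (by simpa [dist_eq_norm] using (Metric.mem_ball.1 hz).le)
  rw [add_sub_cancel] at this
  exact this.mem_weylChamberB (by positivity)

/-- Some closed `δ`-thickening of `K` stays in the chamber; lowering the single coordinate `i` by
`δ` therefore keeps the ordering and the sign, and this is a gap of `δ`. -/
lemma exists_gapGE_of_isCompact {K : Set (EuclideanSpace ℝ (Fin N))} (hK : IsCompact K)
    (hKi : K ⊆ interior (weylChamberB N)) : ∃ c > 0, ∀ q ∈ K, GapGE c q := by
  obtain ⟨δ, hδ, hsub⟩ := hK.exists_cthickening_subset_open isOpen_interior hKi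
  refine ⟨δ, hδ, fun q hq => ?_⟩
  have key : ∀ i : Fin N, q - EuclideanSpace.single i δ ∈ weylChamberB N := fun i => by
    apply interior_subset
    apply hsub
    apply Metric.mem_cthickening_of_dist_le _ q _ _ hq
    simp [abs_of_pos hδ]
  refine ⟨fun i j hij => ?_, fun i => ?_⟩
  · have := (key i).1 i j hij.le
    simp [hij.ne'] at this
    linarith
  · have := (key i).2 i
    simp at this
    linarith

lemma exists_gapGE_of_mem_interior (hq : q ∈ interior (weylChamberB N)) :
    ∃ c > 0, GapGE c q := by
  obtain ⟨c, hc, h⟩ := exists_gapGE_of_isCompact (isCompact_singleton (x := q)) (by simpa using hq)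
  exact ⟨c, hc, h q rfl⟩

lemma interior_weylChamberB_smul {a : ℝ} (ha : 0 < a) (hq : q ∈ interior (weylChamberB N)) :
    a • q ∈ interior (weylChamberB N) := by
  obtain ⟨c, hc, h⟩ := exists_gapGE_of_mem_interior hq
  refine GapGE.mem_interior (c := a * c) (by positivity) ⟨fun i j hij => ?_, fun i => ?_⟩
  · simp only [PiLp.smul_apply, smul_eq_mul, ← mul_sub]
    exact mul_le_mul_of_nonneg_left (h.1 i j hij) ha.le
  · exact mul_le_mul_of_nonneg_left (h.2 i) ha.le

end Chamber

/-! ### Homogeneity, monotonicity and Taylor expansion of the drift -/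

section Drift

variable {N : ℕ}

lemma besselDriftB_apply (k₁ k₂ : ℝ) (x : EuclideanSpace ℝ (Fin N)) (i : Fin N) :
    besselDriftB k₁ k₂ x i =
      k₂ * ∑ j ∈ Finset.univ.erase i, (1 / (x i - x j) + 1 / (x i + x j)) + k₁ / x i := rfl

lemma besselDriftB_mul (ν β : ℝ) (x : EuclideanSpace ℝ (Fin N)) :
    besselDriftB (ν * β) β x = β • besselDriftB ν 1 x := by
  ext i
  simp only [besselDriftB_apply, PiLp.smul_apply, smul_eq_mul]
  ring

lemma besselDriftB_smul (k₁ k₂ a : ℝ) (x : EuclideanSpace ℝ (Fin N)) :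
    besselDriftB k₁ k₂ (a • x) = a⁻¹ • besselDriftB k₁ k₂ x := by
  ext i
  simp only [besselDriftB_apply, PiLp.smul_apply, smul_eq_mul, ← mul_sub, ← mul_add,
    mul_inv, div_eq_mul_inv, ← Finset.mul_sum]
  ring

lemma sub_mul_one_div_sub_nonpos {a b : ℝ} (h : 0 < a * b) : (a - b) * (1 / a - 1 / b) ≤ 0 := by
  have ha : a ≠ 0 := by rintro rfl; simp at h
  have hb : b ≠ 0 := by rintro rfl; simp at h
  have : (a - b) * (1 / a - 1 / b) = -((a - b) ^ 2 / (a * b)) := by field_simp; ring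
  rw [this]
  exact neg_nonpos.2 (by positivity)

lemma GapGE.mul_sub_pos {c d : ℝ} (hc : 0 < c) (hd : 0 < d) {u v : EuclideanSpace ℝ (Fin N)}
    (hu : GapGE c u) (hv : GapGE d v) {i j : Fin N} (hij : i ≠ j) :
    0 < (u i - u j) * (v i - v j) := by
  rcases lt_or_gt_of_ne hij with h | h
  · exact mul_pos (by linarith [hu.1 i j h]) (by linarith [hv.1 i j h])
  · exact mul_pos_of_neg_of_neg (by linarith [hu.1 j i h]) (by linarith [hv.1 j i h])

/-- The drift is monotone: it is the gradient of a concave function on the open chamber. -/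
lemma inner_besselDriftB_sub_nonpos {ν : ℝ} (hν : 0 ≤ ν) {u v : EuclideanSpace ℝ (Fin N)}
    (hu : u ∈ interior (weylChamberB N)) (hv : v ∈ interior (weylChamberB N)) :
    inner ℝ (u - v) (besselDriftB ν 1 u - besselDriftB ν 1 v) ≤ 0 := by
  obtain ⟨c, hc, hu⟩ := exists_gapGE_of_mem_interior hu
  obtain ⟨d, hd, hv⟩ := exists_gapGE_of_mem_interior hv
  let f : Fin N → Fin N → ℝ := fun i j => if j = i then 0 else
    (u i - v i) * ((1 / (u i - u j) - 1 / (v i - v j)) + (1 / (u i + u j) - 1 / (v i + v j)))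
  have h1 : inner ℝ (u - v) (besselDriftB ν 1 u - besselDriftB ν 1 v) =
      ∑ i, (∑ j, f i j + ν * ((u i - v i) * (1 / u i - 1 / v i))) := by
    rw [PiLp.inner_apply]
    refine Finset.sum_congr rfl fun i _ => ?_
    have : ∑ j, f i j = ∑ j ∈ Finset.univ.erase i, f i j := by
      rw [← Finset.add_sum_erase _ _ (Finset.mem_univ i)]
      simp [f]
    rw [this, Finset.sum_congr rfl fun j hj => if_neg (Finset.ne_of_mem_erase hj),
      ← Finset.mul_sum]
    simp only [PiLp.sub_apply, besselDriftB_apply, Finset.sum_add_distrib, Finset.sum_sub_distrib,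
      RCLike.inner_apply, conj_trivial]
    ring
  have h2 : ∑ i, ∑ j, f i j ≤ 0 := by
    -- Symmetrising in `(i, j)` combines the two terms of each pair into `(a - b) (1/a - 1/b)`, once
    -- with coordinate differences and once with sums; `a` and `b` have the same sign in each.
    have hs : ∑ i, ∑ j, f i j = (∑ i, ∑ j, (f i j + f j i)) / 2 := by
      have := Finset.sum_comm (s := Finset.univ) (t := Finset.univ) (f := f)
      simp only [Finset.sum_add_distrib]
      rw [← this]
      ring
    rw [hs]
    have : ∑ i, ∑ j, (f i j + f j i) ≤ 0 := by
      refine Finset.sum_nonpos fun i _ => Finset.sum_nonpos fun j _ => ?_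
      by_cases hij : j = i
      · simp [f, hij]
      · have e1 := sub_mul_one_div_sub_nonpos (hu.mul_sub_pos hc hd hv (Ne.symm hij))
        have e2 := sub_mul_one_div_sub_nonpos (a := u i + u j) (b := v i + v j)
          (mul_pos (by linarith [hu.2 i, hu.2 j]) (by linarith [hv.2 i, hv.2 j]))
        have n1 : 1 / (u j - u i) = - (1 / (u i - u j)) := by rw [← one_div_neg_eq_neg_one_div]; simp
        have n2 : 1 / (v j - v i) = - (1 / (v i - v j)) := by rw [← one_div_neg_eq_neg_one_div]; simp
        simp only [f, if_neg hij, if_neg (Ne.symm hij), n1, n2, add_comm (u j), add_comm (v j)]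
        linarith
    linarith
  rw [h1, Finset.sum_add_distrib]
  refine add_nonpos h2 (Finset.sum_nonpos fun i _ => mul_nonpos_of_nonneg_of_nonpos hν ?_)
  exact sub_mul_one_div_sub_nonpos
    (mul_pos (by linarith [hu.2 i]) (by linarith [hv.2 i]))

/-- The remainder is exactly `δ² / (a² (a + δ))`, and `|a + δ| ≥ c / 2`. In use `δ` is a coordinate
of `h` or a sum or difference of two, whence `|δ| ≤ 2 r` with `r = ‖h‖`. -/
lemma abs_one_div_add_taylor_le {a δ c r : ℝ} (hc : 0 < c) (ha : c ≤ |a|) (hδ : |δ| ≤ c / 2)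
    (hr : |δ| ≤ 2 * r) :
    |1 / (a + δ) - 1 / a + δ / a ^ 2| ≤ 8 / c ^ 3 * r ^ 2 := by
  have ha0 : a ≠ 0 := abs_pos.1 (hc.trans_le ha)
  have h1 : c / 2 ≤ |a + δ| := by
    have := abs_sub_abs_le_abs_sub a (-δ)
    rw [abs_neg, sub_neg_eq_add] at this
    linarith
  have h2 : a + δ ≠ 0 := abs_pos.1 (lt_of_lt_of_le (by positivity) h1)
  have : 1 / (a + δ) - 1 / a + δ / a ^ 2 = δ ^ 2 / (a ^ 2 * (a + δ)) := by field_simp; ring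
  rw [this, abs_div, abs_mul, abs_pow, abs_pow]
  calc |δ| ^ 2 / (|a| ^ 2 * |a + δ|) ≤ (2 * r) ^ 2 / (c ^ 2 * (c / 2)) := by gcongr
    _ = 8 / c ^ 3 * r ^ 2 := by field_simp; ring

lemma norm_le_card_mul {v : EuclideanSpace ℝ (Fin N)} {K : ℝ} (h : ∀ i, |v i| ≤ K) :
    ‖v‖ ≤ N * K := by
  have : v = ∑ i, EuclideanSpace.single i (v i) := by
    ext j; simp [Finset.sum_apply]
  rw [this]
  refine (norm_sum_le _ _).trans ?_
  refine (Finset.sum_le_card_nsmul _ _ K fun i _ => ?_).trans (by simp)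
  simp [h i]

lemma sum_erase_abs_le {i : Fin N} {f : Fin N → ℝ} {K : ℝ} (hK : 0 ≤ K)
    (h : ∀ j, j ≠ i → |f j| ≤ K) : |∑ j ∈ Finset.univ.erase i, f j| ≤ N * K := by
  refine (Finset.abs_sum_le_sum_abs _ _).trans ?_
  refine (Finset.sum_le_card_nsmul _ _ K fun j hj => h j (Finset.ne_of_mem_erase hj)).trans ?_
  rw [nsmul_eq_mul]
  gcongr
  simp

lemma norm_besselDriftB_le (ν : ℝ) {c : ℝ} (hc : 0 < c) {q : EuclideanSpace ℝ (Fin N)}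
    (hq : GapGE c q) : ‖besselDriftB ν 1 q‖ ≤ N * (N * (1 / c + 1 / c) + |ν| / c) := by
  have inv : ∀ a : ℝ, c ≤ |a| → |1 / a| ≤ 1 / c := fun a ha => by
    rw [abs_div, abs_one]; exact one_div_le_one_div_of_le hc ha
  refine norm_le_card_mul fun i => ?_
  rw [besselDriftB_apply, one_mul]
  refine (abs_add_le _ _).trans (add_le_add (sum_erase_abs_le (by positivity) fun j hj => ?_) ?_)
  · exact (abs_add_le _ _).trans
      (add_le_add (inv _ (hq.abs_sub hj.symm)) (inv _ (hq.abs_add hc.le i j)))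
  · rw [abs_div]
    exact div_le_div_of_nonneg_left (abs_nonneg _) hc (hq.abs_self i)

/-- Regrouped by pairs, the linear term matches the drift summand by summand, so that the scalar
Taylor estimate applies to each. -/
lemma limitMatrixB_mulVec_apply (ν : ℝ) (q h : EuclideanSpace ℝ (Fin N)) (i : Fin N) :
    (limitMatrixB ν q).mulVec h i = ∑ j ∈ Finset.univ.erase i,
      (-((h i - h j) / (q i - q j) ^ 2) - (h i + h j) / (q i + q j) ^ 2) - ν * (h i / q i ^ 2) := by
  rw [Matrix.mulVec, dotProduct, ← Finset.add_sum_erase _ _ (Finset.mem_univ i)]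
  have : ∀ j ∈ Finset.univ.erase i, limitMatrixB ν q i j * h j =
      (1 / (q i - q j) ^ 2 - 1 / (q i + q j) ^ 2) * h j := fun j hj => by
    simp [limitMatrixB, (Finset.ne_of_mem_erase hj).symm]
  rw [Finset.sum_congr rfl this]
  simp only [limitMatrixB, Matrix.of_apply, if_true]
  rw [sub_mul, Finset.sum_mul, sub_add_eq_add_sub, ← Finset.sum_add_distrib]
  congr 1
  · exact Finset.sum_congr rfl fun j _ => by ring
  · ring

/-- Second-order Taylor estimate for the drift, whose derivative is `limitMatrixB`. -/
lemma norm_besselDriftB_taylor_le (ν : ℝ) {c : ℝ} (hc : 0 < c) {q h : EuclideanSpace ℝ (Fin N)}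
    (hq : GapGE c q) (hh : ‖h‖ ≤ c / 4) :
    ‖besselDriftB ν 1 (q + h) - besselDriftB ν 1 q -
      WithLp.toLp 2 ((limitMatrixB ν q).mulVec h)‖ ≤
      N * (N * (8 / c ^ 3 + 8 / c ^ 3) + |ν| * (8 / c ^ 3)) * ‖h‖ ^ 2 := by
  have hi := abs_apply_le_norm h
  have key : ∀ a δ : ℝ, c ≤ |a| → |δ| ≤ 2 * ‖h‖ →
      |1 / (a + δ) - 1 / a + δ / a ^ 2| ≤ 8 / c ^ 3 * ‖h‖ ^ 2 := fun a δ ha hδ =>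
    abs_one_div_add_taylor_le hc ha (by linarith) hδ
  rw [mul_assoc]
  refine norm_le_card_mul fun i => ?_
  have e : (besselDriftB ν 1 (q + h) - besselDriftB ν 1 q -
      WithLp.toLp 2 ((limitMatrixB ν q).mulVec h)) i =
      ∑ j ∈ Finset.univ.erase i,
        ((1 / ((q i - q j) + (h i - h j)) - 1 / (q i - q j) + (h i - h j) / (q i - q j) ^ 2) +
        (1 / ((q i + q j) + (h i + h j)) - 1 / (q i + q j) + (h i + h j) / (q i + q j) ^ 2)) +
      ν * (1 / (q i + h i) - 1 / q i + h i / q i ^ 2) := by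
    simp only [PiLp.sub_apply, besselDriftB_apply, limitMatrixB_mulVec_apply, one_mul,
      PiLp.add_apply]
    have : ∀ j, q i + h i - (q j + h j) = (q i - q j) + (h i - h j) := fun j => by ring
    have h' : ∀ j, q i + h i + (q j + h j) = (q i + q j) + (h i + h j) := fun j => by ring
    simp only [this, h', Finset.sum_add_distrib, Finset.sum_sub_distrib, Finset.sum_neg_distrib]
    ring
  rw [e, add_mul, mul_assoc, mul_assoc]
  refine (abs_add_le _ _).trans (add_le_add (sum_erase_abs_le (by positivity) fun j hj => ?_) ?_)
  · rw [add_mul]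
    refine (abs_add_le _ _).trans
      (add_le_add (key _ _ (hq.abs_sub hj.symm) ?_) (key _ _ (hq.abs_add hc.le i j) ?_))
    · exact (abs_sub _ _).trans (by linarith [hi i, hi j])
    · exact (abs_add_le _ _).trans (by linarith [hi i, hi j])
  · rw [abs_mul]
    exact mul_le_mul_of_nonneg_left (key _ _ (hq.abs_self i)
      (by linarith [hi i, norm_nonneg h])) (abs_nonneg _)

lemma continuousOn_besselDriftB (ν : ℝ) :
    ContinuousOn (besselDriftB (N := N) ν 1) (interior (weylChamberB N)) := by
  refine (PiLp.continuous_toLp 2 _).comp_continuousOn (continuousOn_pi.2 fun i => ?_)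
  intro q hq
  obtain ⟨c, hc, hq⟩ := exists_gapGE_of_mem_interior hq
  have ne : ∀ a : ℝ, c ≤ |a| → a ≠ 0 := fun a ha => abs_pos.1 (hc.trans_le ha)
  have hi : ∀ i : Fin N, ContinuousAt (fun q : EuclideanSpace ℝ (Fin N) => q i) q :=
    fun i => by fun_prop
  refine ContinuousAt.continuousWithinAt ((continuousAt_const.mul (tendsto_finsetSum _
    fun j hj => ?_)).add (continuousAt_const.div (hi i) (ne _ (hq.abs_self i))))
  have hj := Finset.ne_of_mem_erase hj
  exact (continuousAt_const.div ((hi i).sub (hi j)) (ne _ (hq.abs_sub hj.symm))).add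
    (continuousAt_const.div ((hi i).add (hi j)) (ne _ (hq.abs_add hc.le i j)))

lemma continuousOn_limitMatrixB (ν : ℝ) :
    ContinuousOn (limitMatrixB (N := N) ν) (interior (weylChamberB N)) := by
  refine continuousOn_pi.2 fun i => continuousOn_pi.2 fun j => ?_
  intro q hq
  obtain ⟨c, hc, hq⟩ := exists_gapGE_of_mem_interior hq
  have ne : ∀ a : ℝ, c ≤ |a| → a ^ 2 ≠ 0 := fun a ha => pow_ne_zero _ (abs_pos.1 (hc.trans_le ha))
  have hi : ∀ i : Fin N, ContinuousAt (fun q : EuclideanSpace ℝ (Fin N) => q i) q :=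
    fun i => by fun_prop
  refine ContinuousAt.continuousWithinAt ?_
  have hd : ∀ (l j : Fin N) (a b : ℝ), l ≠ j → ContinuousAt
      (fun q : EuclideanSpace ℝ (Fin N) => a / (q l - q j) ^ 2 - b / (q l + q j) ^ 2) q :=
    fun l j a b hlj => (continuousAt_const.div (((hi l).sub (hi j)).pow 2)
      (ne _ (hq.abs_sub hlj))).sub
      (continuousAt_const.div (((hi l).add (hi j)).pow 2) (ne _ (hq.abs_add hc.le l j)))
  by_cases hij : i = j
  · simp only [limitMatrixB, Matrix.of_apply, if_pos hij]
    exact (tendsto_finsetSum _ fun l hl => hd _ _ _ _ (Finset.ne_of_mem_erase hl).symm).sub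
      (continuousAt_const.div ((hi i).pow 2) (ne _ (hq.abs_self i)))
  · simp only [limitMatrixB, Matrix.of_apply, if_neg hij]
    exact hd _ _ _ _ hij

end Drift

/-! ### Energy estimate for absolutely continuous curves -/

section Comparison

/-- Product rule for absolutely continuous functions; the Bessel drift is only integrable, so the
primitive need not be differentiable everywhere. -/
lemma sq_primitive_eq {g : ℝ → ℝ} {u₀ T : ℝ} (hg : IntervalIntegrable g volume 0 T) :
    (u₀ + ∫ s in (0 : ℝ)..T, g s) ^ 2 =
      u₀ ^ 2 + ∫ s in (0 : ℝ)..T, 2 * ((u₀ + ∫ r in (0 : ℝ)..s, g r) * g s) := by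
  have hac : AbsolutelyContinuousOnInterval (fun t => u₀ + ∫ s in (0 : ℝ)..t, g s) 0 T :=
    (LipschitzWith.const u₀).lipschitzOnWith.absolutelyContinuousOnInterval.fun_add
      (hg.absolutelyContinuousOnInterval_intervalIntegral (by simp))
  have h := hac.integral_deriv_mul_eq_sub hac
  simp only [intervalIntegral.integral_same, add_zero] at h
  rw [pow_two, pow_two, ← sub_eq_iff_eq_add', ← h]
  apply intervalIntegral.integral_congr_ae
  filter_upwards [hg.ae_hasDerivAt_integral] with s hs hmem
  rw [((hs (uIoc_subset_uIcc hmem) 0 (by simp)).const_add u₀).deriv]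
  ring

variable {N : ℕ}

lemma intervalIntegral_apply {f : ℝ → EuclideanSpace ℝ (Fin N)} {a b : ℝ}
    (hf : IntervalIntegrable f volume a b) (i : Fin N) :
    (∫ s in a..b, f s) i = ∫ s in a..b, f s i :=
  ((EuclideanSpace.proj (𝕜 := ℝ) i).intervalIntegral_comp_comm hf).symm

lemma IntervalIntegrable.euclidean_apply {f : ℝ → EuclideanSpace ℝ (Fin N)} {a b : ℝ}
    (hf : IntervalIntegrable f volume a b) (i : Fin N) :
    IntervalIntegrable (fun s => f s i) volume a b :=
  ⟨(EuclideanSpace.proj (𝕜 := ℝ) i).integrable_comp hf.1,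
    (EuclideanSpace.proj (𝕜 := ℝ) i).integrable_comp hf.2⟩

lemma norm_sq_primitive_eq {f D : ℝ → EuclideanSpace ℝ (Fin N)} {T : ℝ} (hT : 0 ≤ T)
    (hf : IntervalIntegrable f volume 0 T)
    (hD : ∀ t ∈ Icc 0 T, D t = D 0 + ∫ s in (0 : ℝ)..t, f s) :
    IntervalIntegrable (fun s => 2 * inner ℝ (D s) (f s)) volume 0 T ∧
    ‖D T‖ ^ 2 = ‖D 0‖ ^ 2 + ∫ s in (0 : ℝ)..T, 2 * inner ℝ (D s) (f s) := by
  have hft : ∀ t ∈ Icc 0 T, IntervalIntegrable f volume 0 t := fun t ht =>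
    hf.mono_set (by rw [uIcc_of_le ht.1, uIcc_of_le hT]; exact Icc_subset_Icc_right ht.2)
  have hDi : ∀ i, ∀ t ∈ Icc 0 T, D t i = D 0 i + ∫ s in (0 : ℝ)..t, f s i := fun i t ht => by
    rw [hD t ht, PiLp.add_apply, intervalIntegral_apply (hft t ht)]
  have hint : ∀ i, IntervalIntegrable
      (fun s => 2 * ((D 0 i + ∫ r in (0 : ℝ)..s, f r i) * f s i)) volume 0 T := fun i =>
    ((hf.euclidean_apply i).continuousOn_mul (continuousOn_const.add
      (intervalIntegral.continuousOn_primitive_interval' (hf.euclidean_apply i) (by simp)))).const_mul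
      2
  have heq : ∀ s ∈ Icc 0 T, 2 * inner ℝ (D s) (f s) =
      ∑ i, 2 * ((D 0 i + ∫ r in (0 : ℝ)..s, f r i) * f s i) := fun s hs => by
    rw [PiLp.inner_apply, Finset.mul_sum]
    refine Finset.sum_congr rfl fun i _ => ?_
    rw [← hDi i s hs]
    simp [mul_comm]
  have hsum : IntervalIntegrable
      (fun s => ∑ i, 2 * ((D 0 i + ∫ r in (0 : ℝ)..s, f r i) * f s i)) volume 0 T := by
    have := IntervalIntegrable.sum Finset.univ fun i _ => hint i
    simpa [Finset.sum_fn] using this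
  refine ⟨hsum.congr fun s hs => (heq s ?_).symm, ?_⟩
  · rw [uIoc_of_le hT] at hs; exact ⟨hs.1.le, hs.2⟩
  rw [intervalIntegral.integral_congr (g := fun s =>
      ∑ i, 2 * ((D 0 i + ∫ r in (0 : ℝ)..s, f r i) * f s i))
      (fun s hs => heq s (by rwa [uIcc_of_le hT] at hs)),
    intervalIntegral.integral_finsetSum fun i _ => hint i, EuclideanSpace.norm_sq_eq,
    EuclideanSpace.norm_sq_eq, ← Finset.sum_add_distrib]
  refine Finset.sum_congr rfl fun i _ => ?_
  rw [Real.norm_eq_abs, Real.norm_eq_abs, sq_abs, sq_abs, hDi i T ⟨hT, le_rfl⟩]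
  exact sq_primitive_eq (hf.euclidean_apply i)

/-- A curve whose velocity has inner product at most `K ‖D‖` with the position `D`
grows at most linearly. -/
lemma norm_le_of_inner_velocity_le {f D : ℝ → EuclideanSpace ℝ (Fin N)} {T K : ℝ} (hT : 0 ≤ T)
    (hK : 0 ≤ K) (hf : IntervalIntegrable f volume 0 T) (hDc : ContinuousOn D (Icc 0 T))
    (hD : ∀ t ∈ Icc 0 T, D t = D 0 + ∫ s in (0 : ℝ)..t, f s)
    (h : ∀ᵐ s ∂(volume.restrict (Icc 0 T)), inner ℝ (D s) (f s) ≤ K * ‖D s‖) {t : ℝ}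
    (ht : t ∈ Icc 0 T) : ‖D t‖ ≤ ‖D 0‖ + 2 * K * T := by
  -- At a time `r` where `‖D‖` is maximal, `‖D r‖² ≤ ‖D 0‖² + 2 K T ‖D r‖`, which already bounds `‖D
  -- r‖` without Grönwall.
  obtain ⟨r, hr, hmax⟩ := isCompact_Icc.exists_isMaxOn ⟨t, ht⟩ hDc.norm
  have hsub : Icc 0 r ⊆ Icc 0 T := Icc_subset_Icc_right hr.2
  refine (hmax ht).trans ?_
  change ‖D r‖ ≤ _
  obtain ⟨hint, hsq⟩ := norm_sq_primitive_eq hr.1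
    (hf.mono_set (by rwa [uIcc_of_le hr.1, uIcc_of_le hT])) fun t ht => hD t (hsub ht)
  have hle : ∫ s in (0 : ℝ)..r, 2 * inner ℝ (D s) (f s) ≤ ∫ s in (0 : ℝ)..r, 2 * (K * ‖D r‖) := by
    refine intervalIntegral.integral_mono_ae_restrict hr.1 hint (by simp) ?_
    filter_upwards [ae_restrict_of_ae_restrict_of_subset hsub h,
      ae_restrict_mem measurableSet_Icc] with s hs hmem
    exact mul_le_mul_of_nonneg_left
      (hs.trans (mul_le_mul_of_nonneg_left (hmax (hsub hmem)) hK)) zero_le_two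
  rw [intervalIntegral.integral_const, sub_zero, smul_eq_mul] at hle
  have h1 : r * (2 * (K * ‖D r‖)) ≤ T * (2 * (K * ‖D r‖)) :=
    mul_le_mul_of_nonneg_right hr.2 (by positivity)
  by_contra! hlt
  have h0 := norm_nonneg (D 0)
  have hKT : 0 ≤ K * T := mul_nonneg hK hT
  nlinarith [mul_lt_mul_of_pos_left hlt (by linarith : 0 < ‖D r‖),
    mul_le_mul_of_nonneg_right (by linarith : ‖D 0‖ ≤ ‖D r‖) h0]

end Comparison

/-! ### A priori bound for the linear equation -/

section LinearEquation

variable {E : Type*} [NormedAddCommGroup E] [NormedSpace ℝ E] [CompleteSpace E]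

/-- Grönwall estimate for the linear equation `w = g + ∫ F w`. -/
lemma norm_le_of_linear_integral_eq {F : ℝ → E →L[ℝ] E} {w g : ℝ → E} {T K M : ℝ}
    (hK : 0 < K) (hM : 0 ≤ M)
    (hF : ContinuousOn F (Icc 0 T)) (hFK : ∀ s ∈ Icc 0 T, ‖F s‖ ≤ K)
    (hw : ContinuousOn w (Icc 0 T)) (hg : ∀ s ∈ Icc 0 T, ‖g s‖ ≤ M)
    (heq : ∀ s ∈ Icc 0 T, w s = g s + ∫ r in (0 : ℝ)..s, F r (w r)) {t : ℝ} (ht : t ∈ Icc 0 T) :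
    ‖w t‖ ≤ M * Real.exp (K * T) := by
  have hT : 0 ≤ T := ht.1.trans ht.2
  have hc : ContinuousOn (fun r => F r (w r)) (Icc 0 T) := hF.clm_apply hw
  -- Only the integral part is differentiable, `g` being merely bounded; Grönwall is applied to `v`.
  set v : ℝ → E := fun s => ∫ r in (0 : ℝ)..s, F r (w r) with hv
  have hint : IntervalIntegrable (fun r => F r (w r)) volume 0 T := by
    apply ContinuousOn.intervalIntegrable; rwa [uIcc_of_le hT]
  have hvc : ContinuousOn v (Icc 0 T) := by
    have := intervalIntegral.continuousOn_primitive_interval' hint (a := 0) (by simp)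
    rwa [uIcc_of_le hT] at this
  have hder : ∀ s ∈ Ico 0 T, HasDerivWithinAt v (F s (w s)) (Ici s) s := fun s hs => by
    have hsT : Icc 0 T ∈ 𝓝[>] s :=
      mem_of_superset (Ioc_mem_nhdsGT hs.2) fun r hr => ⟨hs.1.trans hr.1.le, hr.2⟩
    exact intervalIntegral.integral_hasDerivWithinAt_right
      (hint.mono_set (by
        rw [uIcc_of_le hs.1, uIcc_of_le hT]; exact Icc_subset_Icc_right hs.2.le))
      ⟨Icc 0 T, hsT, hc.aestronglyMeasurable measurableSet_Icc⟩
      ((hc s ⟨hs.1, hs.2.le⟩).mono_of_mem_nhdsWithin hsT)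
  have hbound : ∀ s ∈ Ico 0 T, ‖F s (w s)‖ ≤ K * ‖v s‖ + K * M := fun s hs => by
    have hs' : s ∈ Icc 0 T := ⟨hs.1, hs.2.le⟩
    have h1 : ‖w s‖ ≤ M + ‖v s‖ := by
      rw [heq s hs']; exact (norm_add_le _ _).trans (add_le_add (hg s hs') le_rfl)
    calc ‖F s (w s)‖ ≤ ‖F s‖ * ‖w s‖ := (F s).le_opNorm _
      _ ≤ K * (M + ‖v s‖) := mul_le_mul (hFK s hs') h1 (norm_nonneg _) hK.le
      _ = _ := by ring
  have := norm_le_gronwallBound_of_norm_deriv_right_le hvc hder (δ := 0) (by simp [v]) hbound t ht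
  rw [gronwallBound_of_K_ne_0 hK.ne'] at this
  beta_reduce at this
  rw [sub_zero, zero_mul, zero_add,
    mul_div_cancel_left₀ _ hK.ne'] at this
  have hexp : Real.exp (K * t) ≤ Real.exp (K * T) :=
    Real.exp_le_exp.2 (mul_le_mul_of_nonneg_left ht.2 hK.le)
  rw [heq t ht]
  calc ‖g t + v t‖ ≤ M + M * (Real.exp (K * t) - 1) :=
        (norm_add_le _ _).trans (add_le_add (hg t ht) this)
    _ = M * Real.exp (K * t) := by ring
    _ ≤ _ := mul_le_mul_of_nonneg_left hexp hM

end LinearEquation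

/-! ### Pathwise error bound, uniform in the multiplicity -/

section Pathwise

variable {N : ℕ}

/-- The matrix `limitMatrixB ν q` as an operator on Euclidean space. -/
noncomputable def limitOperatorB (ν : ℝ) (q : EuclideanSpace ℝ (Fin N)) :
    EuclideanSpace ℝ (Fin N) →L[ℝ] EuclideanSpace ℝ (Fin N) :=
  Matrix.toEuclideanCLM (𝕜 := ℝ) (limitMatrixB ν q)

lemma limitOperatorB_apply (ν : ℝ) (q h : EuclideanSpace ℝ (Fin N)) :
    limitOperatorB ν q h = WithLp.toLp 2 ((limitMatrixB ν q).mulVec h) := rfl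

lemma continuousOn_limitOperatorB (ν : ℝ) :
    ContinuousOn (limitOperatorB (N := N) ν) (interior (weylChamberB N)) := by
  have : Continuous (Matrix.toEuclideanCLM (n := Fin N) (𝕜 := ℝ)) :=
    (Matrix.toEuclideanCLM (n := Fin N) (𝕜 := ℝ)).toAlgEquiv.toLinearMap.continuous_of_finiteDimensional
  exact this.comp_continuousOn (continuousOn_limitMatrixB ν)

variable {ν : ℝ} {x y : EuclideanSpace ℝ (Fin N)} {φ b w p : ℝ → EuclideanSpace ℝ (Fin N)}

lemma IsLimitFlowB.continuousOn (hφ : IsLimitFlowB ν x φ) : ContinuousOn φ (Ici 0) :=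
  fun t ht => (hφ.hasDerivWithinAt t ht).continuousWithinAt

lemma IsLimitFlowB.continuousOn_drift (hφ : IsLimitFlowB ν x φ) :
    ContinuousOn (fun s => besselDriftB ν 1 (φ s)) (Ici 0) :=
  (continuousOn_besselDriftB ν).comp hφ.continuousOn fun t ht => hφ.mem_interior t ht

lemma IsLimitFlowB.continuousOn_operator (hφ : IsLimitFlowB ν x φ) :
    ContinuousOn (fun s => limitOperatorB ν (φ s)) (Ici 0) :=
  (continuousOn_limitOperatorB ν).comp hφ.continuousOn fun t ht => hφ.mem_interior t ht

lemma ContinuousOn.intervalIntegrable_of_Ici {E : Type*} [NormedAddCommGroup E] {f : ℝ → E}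
    (hf : ContinuousOn f (Ici 0)) {t : ℝ} (ht : 0 ≤ t) : IntervalIntegrable f volume 0 t := by
  apply ContinuousOn.intervalIntegrable
  rw [uIcc_of_le ht]
  exact hf.mono Icc_subset_Ici_self

lemma IsLimitFlowB.eq_integral (hφ : IsLimitFlowB ν x φ) {t : ℝ} (ht : 0 ≤ t) :
    φ t = x + ∫ s in (0 : ℝ)..t, besselDriftB ν 1 (φ s) := by
  rw [intervalIntegral.integral_eq_sub_of_hasDeriv_right_of_le ht
    (hφ.continuousOn.mono Icc_subset_Ici_self)
    (fun s hs => (hφ.hasDerivWithinAt s hs.1.le).mono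
      fun r hr => hs.1.le.trans (le_of_lt hr)) (hφ.continuousOn_drift.intervalIntegrable_of_Ici ht),
    hφ.initial, add_sub_cancel]

/-- Comparison of a Bessel path with `√λ φ + w`, driven by the same path `b`. -/
lemma norm_besselPath_sub_le (hν : 0 ≤ ν) (hφ : IsLimitFlowB ν x φ) (hw : IsLimitPathB ν φ y b w)
    {β a T K : ℝ} (hβ : 0 ≤ β) (hT : 0 ≤ T) (hK : 0 ≤ K)
    (hp : IsBesselPathB (ν * β) β (√β • x + y) b p)
    (hz : ∀ s ∈ Icc 0 T, a • φ s + w s ∈ interior (weylChamberB N))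
    (hzK : ∀ s ∈ Icc 0 T, ‖β • besselDriftB ν 1 (a • φ s + w s) - a • besselDriftB ν 1 (φ s) -
      limitOperatorB ν (φ s) (w s)‖ ≤ K) {t : ℝ} (ht : t ∈ Icc 0 T) :
    ‖p t - (a • φ t + w t)‖ ≤ |√β - a| * ‖x‖ + 2 * K * T := by
  have hi1 := fun t (ht : 0 ≤ t) => hp.intervalIntegrable t ht
  have hi2 : ∀ t, 0 ≤ t → IntervalIntegrable (fun s => a • besselDriftB ν 1 (φ s)) volume 0 t :=
    fun t ht => (hφ.continuousOn_drift.intervalIntegrable_of_Ici ht).smul a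
  have hi3 := fun t (ht : 0 ≤ t) =>
    (hφ.continuousOn_operator.clm_apply hw.continuousOn).intervalIntegrable_of_Ici ht
  have hp0 := hp.eq_integral 0 le_rfl
  have hw0 := hw.eq_integral 0 le_rfl
  simp only [intervalIntegral.integral_same, add_zero] at hp0 hw0
  have hd0 : p 0 - (a • φ 0 + w 0) = (√β - a) • x := by
    rw [hp0, hw0, hφ.initial]; module
  have key := norm_le_of_inner_velocity_le (D := fun s => p s - (a • φ s + w s))
    (f := fun s => besselDriftB (ν * β) β (p s) - a • besselDriftB ν 1 (φ s) -
      limitOperatorB ν (φ s) (w s)) hT hK (((hi1 T hT).sub (hi2 T hT)).sub (hi3 T hT))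
    ((hp.continuousOn.sub ((hφ.continuousOn.const_smul a).add hw.continuousOn)).mono
      Icc_subset_Ici_self) ?_ ?_ ht
  · simpa only [hd0, norm_smul, Real.norm_eq_abs] using key
  · intro t ht
    rw [intervalIntegral.integral_sub ((hi1 t ht.1).sub (hi2 t ht.1)) (hi3 t ht.1),
      intervalIntegral.integral_sub (hi1 t ht.1) (hi2 t ht.1)]
    rw [hd0, intervalIntegral.integral_smul, hp.eq_integral t ht.1, hw.eq_integral t ht.1,
      hφ.eq_integral ht.1]
    simp only [limitOperatorB_apply]
    module
  · filter_upwards [ae_restrict_of_ae_restrict_of_subset Icc_subset_Ici_self hp.ae_mem_interior,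
      ae_restrict_mem measurableSet_Icc] with s hs hmem
    set z := a • φ s + w s with hzdef
    have hmono := inner_besselDriftB_sub_nonpos hν hs (hz s hmem)
    -- Monotone part plus consistency error. The former needs `p s` in the interior, which is known
    -- only for almost every `s`.
    have heq : besselDriftB (ν * β) β (p s) - a • besselDriftB ν 1 (φ s) -
        limitOperatorB ν (φ s) (w s) = β • (besselDriftB ν 1 (p s) - besselDriftB ν 1 z) +
        (β • besselDriftB ν 1 z - a • besselDriftB ν 1 (φ s) - limitOperatorB ν (φ s) (w s)) := by
      rw [besselDriftB_mul]; module
    rw [heq, inner_add_right, inner_smul_right]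
    have h1 := mul_nonpos_of_nonneg_of_nonpos hβ hmono
    have h2 := (real_inner_le_norm (p s - z) _).trans
      (mul_le_mul_of_nonneg_left (hzK s hmem) (norm_nonneg _))
    linarith

/-- On `[0, T]` the scaled error is bounded by a constant that depends on the driving path only
through a bound of its norm. -/
lemma exists_scaled_error_bound (hν : 0 ≤ ν) (hφ : IsLimitFlowB ν x φ) {β₀ : ℝ} (hβ₀ : 0 < β₀)
    (y : EuclideanSpace ℝ (Fin N)) {T : ℝ} (hT : 0 ≤ T) (R : ℝ) :
    ∃ C : ℝ, ∀ b w, IsLimitPathB ν φ y b w → (∀ s ∈ Icc 0 T, ‖b s‖ ≤ R) → ∀ β, β₀ ≤ β → ∀ p,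
      IsBesselPathB (ν * β) β (√β • x + y) b p → ∀ s ∈ Icc 0 T,
      √β * ‖p s - √β • φ s - w s‖ ≤ C := by
  have hsub : Icc 0 T ⊆ Ici 0 := Icc_subset_Ici_self
  obtain ⟨c, hc, hgap⟩ := exists_gapGE_of_isCompact
    (isCompact_Icc.image_of_continuousOn (hφ.continuousOn.mono hsub))
    (by rintro _ ⟨s, hs, rfl⟩; exact hφ.mem_interior s hs.1)
  replace hgap : ∀ s ∈ Icc 0 T, GapGE c (φ s) := fun s hs => hgap _ (mem_image_of_mem _ hs)
  obtain ⟨KA, hKA⟩ := isCompact_Icc.exists_bound_of_continuousOn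
    (hφ.continuousOn_operator.mono hsub)
  obtain ⟨Kφ, hKφ⟩ := isCompact_Icc.exists_bound_of_continuousOn (hφ.continuousOn.mono hsub)
  have h0T : (0 : ℝ) ∈ Icc 0 T := ⟨le_rfl, hT⟩
  have hKA0 : 0 ≤ KA := (norm_nonneg _).trans (hKA 0 h0T)
  have hKφ0 : 0 ≤ Kφ := (norm_nonneg _).trans (hKφ 0 h0T)
  set KH : ℝ := N * (N * (1 / (c / 2) + 1 / (c / 2)) + |ν| / (c / 2)) with hKH
  set KT : ℝ := N * (N * (8 / c ^ 3 + 8 / c ^ 3) + |ν| * (8 / c ^ 3)) with hKT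
  have hKH0 : 0 ≤ KH := by positivity
  have hKT0 : 0 ≤ KT := by positivity
  -- A bound for `‖w‖` on `[0, T]`; the `+ 1` makes the Grönwall constant positive.
  set M : ℝ := (‖y‖ + |R|) * Real.exp ((KA + 1) * T) with hMdef
  have hM0 : 0 ≤ M := by positivity
  -- For `a ≥ l` the point `φ + w / a` keeps the gap `c / 2`; the entry `√β₀` makes `l` positive
  -- even if `M = 0`.
  set l : ℝ := max (√β₀) (4 * M / c) with hl
  have hl0 : 0 < l := lt_max_of_lt_left (Real.sqrt_pos.2 hβ₀)
  have hMl : ∀ {a : ℝ}, l ≤ a → M / a ≤ c / 4 := fun {a} ha => by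
    have ha0 : 0 < a := hl0.trans_le ha
    have h1 : 4 * M / c ≤ a := (le_max_right _ _).trans ha
    rw [div_le_iff₀ hc] at h1
    rw [div_le_iff₀ ha0]
    linarith
  refine ⟨max (2 * (KT * M ^ 2) * T)
    (l * ((l * ‖x‖ + 2 * (l * KH + l * KH + KA * M) * T) + l * Kφ)), ?_⟩
  intro b w hw hb β hβ p hp s hs
  have hβ0 : 0 < β := hβ₀.trans_le hβ
  have hsβ : 0 < √β := Real.sqrt_pos.2 hβ0
  have hwM : ∀ s ∈ Icc 0 T, ‖w s‖ ≤ M := fun s hs =>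
    norm_le_of_linear_integral_eq (g := fun s => y + b s) (F := fun s => limitOperatorB ν (φ s))
      (by positivity) (by positivity) (hφ.continuousOn_operator.mono hsub)
      (fun s hs => (hKA s hs).trans (by linarith)) (hw.continuousOn.mono hsub)
      (fun s hs => (norm_add_le _ _).trans
        (add_le_add le_rfl ((hb s hs).trans (le_abs_self R))))
      (fun s hs => hw.eq_integral s hs.1) hs
  have hsplit : ∀ {a : ℝ}, 0 < a → ∀ s, a • φ s + w s = a • (φ s + a⁻¹ • w s) := fun ha s => by
    rw [smul_add, smul_inv_smul₀ ha.ne']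
  have hpert : ∀ {a : ℝ}, l ≤ a → ∀ s ∈ Icc 0 T, ‖a⁻¹ • w s‖ ≤ c / 4 := fun {a} ha s hs => by
    have ha0 : 0 < a := hl0.trans_le ha
    rw [norm_smul, norm_inv, Real.norm_eq_abs, abs_of_pos ha0, inv_mul_eq_div]
    exact (div_le_div_of_nonneg_right (hwM s hs) ha0.le).trans (hMl ha)
  have hzint : ∀ {a : ℝ}, l ≤ a → ∀ s ∈ Icc 0 T, a • φ s + w s ∈ interior (weylChamberB N) :=
    fun {a} ha s hs => by
      have ha0 : 0 < a := hl0.trans_le ha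
      rw [hsplit ha0]
      exact interior_weylChamberB_smul ha0
        (((hgap s hs).add (hpert ha s hs)).mem_interior (by positivity))
  rcases le_or_gt l (√β) with hlβ | hlβ
  -- Large `β`: with `a = √β` the initial error vanishes and the Taylor estimate applies.
  · refine le_max_of_le_left ?_
    have key := norm_besselPath_sub_le hν hφ hw hβ0.le hT (K := KT * M ^ 2 / √β) (by positivity)
      hp (hzint hlβ) (fun r hr => ?_) hs
    · rw [sub_self, abs_zero, zero_mul, zero_add, ← sub_sub] at key
      calc √β * ‖p s - √β • φ s - w s‖ ≤ √β * (2 * (KT * M ^ 2 / √β) * T) := by gcongr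
        _ = _ := by field_simp
    · have hT2 := norm_besselDriftB_taylor_le ν hc (hgap r hr) (hpert hlβ r hr)
      have e : β • besselDriftB ν 1 (√β • φ r + w r) - √β • besselDriftB ν 1 (φ r) -
          limitOperatorB ν (φ r) (w r) = √β • (besselDriftB ν 1 (φ r + (√β)⁻¹ • w r) -
          besselDriftB ν 1 (φ r) - limitOperatorB ν (φ r) ((√β)⁻¹ • w r)) := by
        rw [hsplit hsβ, besselDriftB_smul, smul_sub, smul_sub, map_smul, smul_inv_smul₀ hsβ.ne',
          smul_smul]
        congr 3
        nth_rewrite 1 [← Real.mul_self_sqrt hβ0.le]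
        field_simp
      rw [e, norm_smul, Real.norm_eq_abs, abs_of_pos hsβ]
      calc √β * _ ≤ √β * (KT * ‖(√β)⁻¹ • w r‖ ^ 2) :=
            mul_le_mul_of_nonneg_left hT2 hsβ.le
        _ ≤ √β * (KT * (M / √β) ^ 2) := by
            rw [norm_smul, norm_inv, Real.norm_eq_abs, abs_of_pos hsβ, inv_mul_eq_div]
            gcongr
            exact hwM r hr
        _ = KT * M ^ 2 / √β := by field_simp
  -- Small `β`: compare with `l • φ + w`, which lies in the chamber, then replace `l` by `√β` at a
  -- bounded cost.
  · refine le_max_of_le_right ?_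
    have hβl : β ≤ l ^ 2 := by
      rw [← Real.sq_sqrt hβ0.le]; gcongr
    have hHb : ∀ r ∈ Icc 0 T, ‖besselDriftB ν 1 (φ r)‖ ≤ KH := fun r hr =>
      norm_besselDriftB_le ν (by positivity)
        ⟨fun i j hij => by linarith [(hgap r hr).1 i j hij], fun i => by linarith [(hgap r hr).2 i]⟩
    have key := norm_besselPath_sub_le hν hφ hw hβ0.le hT (K := l * KH + l * KH + KA * M)
      (by positivity) hp (hzint le_rfl) (fun r hr => ?_) hs
    · have habs : |√β - l| ≤ l := by
        rw [abs_le]; constructor <;> linarith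
      have e : p s - √β • φ s - w s = (p s - (l • φ s + w s)) - (√β - l) • φ s := by module
      have h2 : ‖p s - √β • φ s - w s‖ ≤
          (l * ‖x‖ + 2 * (l * KH + l * KH + KA * M) * T) + l * Kφ := by
        rw [e]
        refine (norm_sub_le _ _).trans (add_le_add (key.trans ?_) ?_)
        · gcongr
        · rw [norm_smul, Real.norm_eq_abs]
          exact mul_le_mul habs (hKφ s hs) (norm_nonneg _) hl0.le
      exact mul_le_mul hlβ.le h2 (norm_nonneg _) hl0.le
    · refine (norm_sub_le _ _).trans (add_le_add ((norm_sub_le _ _).trans (add_le_add ?_ ?_)) ?_)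
      · rw [hsplit hl0, besselDriftB_smul, smul_smul, norm_smul, Real.norm_eq_abs]
        refine mul_le_mul ?_ (norm_besselDriftB_le ν (by positivity)
          ((hgap r hr).add (hpert le_rfl r hr))) (norm_nonneg _) hl0.le
        rw [abs_of_pos (by positivity), ← div_eq_mul_inv, div_le_iff₀ hl0, ← pow_two]
        exact hβl
      · rw [norm_smul, Real.norm_eq_abs, abs_of_pos hl0]
        exact mul_le_mul_of_nonneg_left (hHb r hr) hl0.le
      · exact ((limitOperatorB ν (φ r)).le_opNorm _).trans
          (mul_le_mul (hKA r hr) (hwM r hr) (norm_nonneg _) hKA0)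

end Pathwise

/-! ### Almost sure limits of Gaussian variables and processes -/

section GaussianLimit

variable {Ω : Type*} [MeasurableSpace Ω] {P : Measure Ω}

lemma tendsto_charFun_of_ae_tendsto [IsProbabilityMeasure P] {Z : ℕ → Ω → ℝ} {Y : Ω → ℝ}
    (hZ : ∀ n, AEMeasurable (Z n) P) (hY : AEMeasurable Y P)
    (h : ∀ᵐ ω ∂P, Tendsto (fun n => Z n ω) atTop (𝓝 (Y ω))) (t : ℝ) :
    Tendsto (fun n => charFun (P.map (Z n)) t) atTop (𝓝 (charFun (P.map Y) t)) := by
  have e : ∀ V : Ω → ℝ, AEMeasurable V P →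
      charFun (P.map V) t = ∫ ω, Complex.exp (t * V ω * Complex.I) ∂P := fun V hV => by
    rw [charFun_apply_real, integral_map hV (by fun_prop)]
  simp_rw [e Y hY, fun n => e (Z n) (hZ n)]
  refine tendsto_integral_of_dominated_convergence (fun _ => 1) (fun n => ?_) (by simp)
    (fun n => ae_of_all _ fun ω => ?_) ?_
  · have hm : Measurable fun x : ℝ => Complex.exp (t * x * Complex.I) := by fun_prop
    exact (hm.comp_aemeasurable (hZ n)).aestronglyMeasurable
  · rw [← Complex.ofReal_mul, Complex.norm_exp_ofReal_mul_I]
  · filter_upwards [h] with ω hω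
    have hc : Continuous fun x : ℝ => Complex.exp (t * x * Complex.I) := by fun_prop
    exact (hc.tendsto _).comp hω

lemma norm_charFun_gaussianReal (m : ℝ) (v : ℝ≥0) (t : ℝ) :
    ‖charFun (gaussianReal m v) t‖ = Real.exp (-(v * t ^ 2 / 2)) := by
  rw [charFun_gaussianReal, Complex.norm_exp]
  congr 1
  simp only [Complex.sub_re, Complex.mul_re, Complex.ofReal_re, Complex.ofReal_im, Complex.I_re,
    Complex.I_im]
  have : ((v : ℂ) * (t : ℂ) ^ 2 / 2).re = v * t ^ 2 / 2 := by
    rw [show ((v : ℂ) * (t : ℂ) ^ 2 / 2) = ((v * t ^ 2 / 2 : ℝ) : ℂ) by push_cast; rfl,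
      Complex.ofReal_re]
  rw [this]
  simp

/-- If the characteristic functions of real Gaussian laws converge pointwise to that of a
probability measure, then a subsequence of the means and variances converges. -/
lemma exists_gaussianReal_of_tendsto_charFun {μ : Measure ℝ} [IsProbabilityMeasure μ]
    {m : ℕ → ℝ} {v : ℕ → ℝ≥0}
    (h : ∀ t, Tendsto (fun n => charFun (gaussianReal (m n) (v n)) t) atTop (𝓝 (charFun μ t))) :
    ∃ m₀ v₀, μ = gaussianReal m₀ v₀ := by
  obtain ⟨t₀, ht₀, hne⟩ : ∃ t₀ : ℝ, t₀ ≠ 0 ∧ charFun μ t₀ ≠ 0 := by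
    have hc : ContinuousAt (charFun μ) 0 := continuous_charFun.continuousAt
    have h1 : ∀ᶠ t in 𝓝[≠] (0 : ℝ), charFun μ t ≠ 0 :=
      (hc.eventually_ne (by simp)).filter_mono nhdsWithin_le_nhds
    obtain ⟨t, h2, h3⟩ := (h1.and self_mem_nhdsWithin).exists
    exact ⟨t, h3, h2⟩
  -- The modulus of a Gaussian characteristic function depends on the variance alone, so its
  -- logarithm at `t₀` recovers `v n`.
  obtain ⟨v₀, hv₀⟩ : ∃ v₀ : ℝ≥0, Tendsto v atTop (𝓝 v₀) := by
    have h1 := ((h t₀).norm).log (norm_ne_zero_iff.2 hne)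
    simp only [norm_charFun_gaussianReal, Real.log_exp] at h1
    have h2 := h1.const_mul (-2 / t₀ ^ 2)
    have h3 : Tendsto (fun n => (v n : ℝ)) atTop (𝓝 (-2 / t₀ ^ 2 * Real.log ‖charFun μ t₀‖)) := by
      refine h2.congr fun n => ?_
      field_simp
    have h4 := (continuous_real_toNNReal.tendsto _).comp h3
    exact ⟨_, h4.congr fun n => Real.toNNReal_coe⟩
  have hvc : Tendsto (fun n => ((v n : ℝ) : ℂ)) atTop (𝓝 ((v₀ : ℝ) : ℂ)) :=
    (Complex.continuous_ofReal.tendsto _).comp ((NNReal.tendsto_coe).2 hv₀)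
  have hexp : ∀ t : ℝ, Tendsto (fun n => Complex.exp ((v n : ℝ) * (t : ℂ) ^ 2 / 2)) atTop
      (𝓝 (Complex.exp ((v₀ : ℝ) * (t : ℂ) ^ 2 / 2))) := fun t =>
    (Complex.continuous_exp.tendsto _).comp ((hvc.mul_const _).div_const _)
  -- Dividing out the variance leaves Dirac masses at the means. Their characteristic functions
  -- converge to a function continuous at `0`, so they are tight; a Dirac mass with at most `1 / 2`
  -- outside `K` sits in `K`.
  have hdirac : ∀ t, Tendsto (fun n => charFun (Measure.dirac (m n)) t) atTop
      (𝓝 (charFun μ t * Complex.exp ((v₀ : ℝ) * (t : ℂ) ^ 2 / 2))) := fun t => by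
    refine ((h t).mul (hexp t)).congr fun n => ?_
    rw [charFun_gaussianReal, ← Complex.exp_add, charFun_dirac]
    simp
  have htight := isTightMeasureSet_of_tendsto_charFun
    (continuous_charFun.mul (by fun_prop)).continuousAt hdirac
  rw [isTightMeasureSet_iff_exists_isCompact_measure_compl_le] at htight
  obtain ⟨K, hK, hKm⟩ := htight (1 / 2) (by simp)
  have hmem : ∀ n, m n ∈ K := fun n => by
    by_contra hn
    have := hKm _ (mem_range_self n)
    rw [Measure.dirac_apply' _ hK.measurableSet.compl, indicator_of_mem hn] at this
    simp at this
  obtain ⟨m₀, -, σ, hσ, hm₀⟩ := hK.tendsto_subseq hmem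
  refine ⟨m₀, v₀, Measure.ext_of_charFun (funext fun t => ?_)⟩
  refine tendsto_nhds_unique ((h t).comp hσ.tendsto_atTop) ?_
  simp only [Function.comp_def, charFun_gaussianReal]
  have hmc : Tendsto (fun n => ((m (σ n) : ℝ) : ℂ)) atTop (𝓝 (m₀ : ℂ)) :=
    (Complex.continuous_ofReal.tendsto _).comp hm₀
  exact (Complex.continuous_exp.tendsto _).comp (((hmc.const_mul _).mul_const _).sub
    (((hvc.comp hσ.tendsto_atTop).mul_const _).div_const _))

variable {E : Type*} [NormedAddCommGroup E] [NormedSpace ℝ E] [MeasurableSpace E] [BorelSpace E]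

/-- An almost sure limit of Gaussian random variables is Gaussian. -/
lemma ProbabilityTheory.HasGaussianLaw.of_ae_tendsto {Z : ℕ → Ω → E} {Y : Ω → E}
    (hZ : ∀ n, HasGaussianLaw (Z n) P)
    (h : ∀ᵐ ω ∂P, Tendsto (fun n => Z n ω) atTop (𝓝 (Y ω))) : HasGaussianLaw Y P where
  isGaussian_map := by
    have := (hZ 0).isProbabilityMeasure
    have hY : AEMeasurable Y P := aemeasurable_of_tendsto_metrizable_ae' (fun n => (hZ n).aemeasurable) h
    refine isGaussian_of_map_eq_gaussianReal fun L => ?_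
    have hLY : AEMeasurable (fun ω => L (Y ω)) P := L.measurable.comp_aemeasurable hY
    have e : (P.map Y).map L = P.map fun ω => L (Y ω) :=
      AEMeasurable.map_map_of_aemeasurable L.measurable.aemeasurable hY
    rw [e]
    have := P.isProbabilityMeasure_map hLY
    refine exists_gaussianReal_of_tendsto_charFun (m := fun n => ∫ ω, L (Z n ω) ∂P)
      (v := fun n => (variance (fun ω => L (Z n ω)) P).toNNReal) fun t => ?_
    have := tendsto_charFun_of_ae_tendsto (Z := fun n ω => L (Z n ω))
      (fun n => ((hZ n).map_fun L).aemeasurable) hLY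
      (h.mono fun ω hω => (L.continuous.tendsto _).comp hω) t
    simpa only [fun n => ((hZ n).map_fun L).map_eq_gaussianReal] using this

variable [SecondCountableTopology E] {T : Type*}

lemma ProbabilityTheory.IsGaussianProcess.of_ae_tendsto {Z : ℕ → T → Ω → E} {Y : T → Ω → E}
    (hZ : ∀ n, IsGaussianProcess (Z n) P)
    (h : ∀ t, ∀ᵐ ω ∂P, Tendsto (fun n => Z n t ω) atTop (𝓝 (Y t ω))) :
    IsGaussianProcess Y P where
  hasGaussianLaw I := by
    refine HasGaussianLaw.of_ae_tendsto (fun n => (hZ n).hasGaussianLaw I) ?_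
    have : ∀ᵐ ω ∂P, ∀ t : I, Tendsto (fun n => Z n t ω) atTop (𝓝 (Y t ω)) :=
      ae_all_iff.2 fun t => h t
    filter_upwards [this] with ω hω
    exact tendsto_pi_nhds.2 hω

lemma ProbabilityTheory.IsGaussianProcess.const_add {Z : T → Ω → E} (hZ : IsGaussianProcess Z P) (c : T → E) :
    IsGaussianProcess (fun t ω => c t + Z t ω) P where
  hasGaussianLaw I := by
    have hI := hZ.hasGaussianLaw I
    have := hI.isGaussian_map
    constructor
    have e : P.map (fun ω => I.restrict (fun t => c t + Z t ω)) =
        (P.map fun ω => I.restrict (Z · ω)).map (fun u => I.restrict c + u) := by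
      rw [AEMeasurable.map_map_of_aemeasurable (by fun_prop) hI.aemeasurable]
      rfl
    rw [e]
    infer_instance

end GaussianLimit

/-! ### Joint Gaussianity of vector Brownian motion -/

section BrownianMotion

variable {N : ℕ} {Ω : Type*} [MeasurableSpace Ω] {P : Measure Ω}
  {B : ℝ → Ω → EuclideanSpace ℝ (Fin N)}

lemma IsBrownianMotion.isGaussianProcess (hB : IsBrownianMotion B P) :
    IsGaussianProcess (fun (t : ℝ≥0) ω => B t ω) P where
  hasGaussianLaw I := by
    have h1 : ∀ i, HasGaussianLaw (fun ω => I.restrict (fun t : ℝ≥0 => B t ω i)) P := fun i =>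
      have hG := IsPreBrownianReal.isGaussianProcess (hB.isBrownianReal i).toIsPreBrownianReal
      hG.hasGaussianLaw I
    have h2 : iIndepFun (fun i ω => I.restrict (fun t : ℝ≥0 => B t ω i)) P :=
      hB.indep.comp (fun _ u => I.restrict u) fun _ => by fun_prop
    have h3 := iIndepFun.hasGaussianLaw h1 h2
    -- Independent Gaussian coordinate vectors are jointly Gaussian; `L` only exchanges the indices
    -- of coordinate and time.
    let L : (Fin N → I → ℝ) →L[ℝ] (I → EuclideanSpace ℝ (Fin N)) :=
      ContinuousLinearMap.pi fun t =>
        (EuclideanSpace.equiv (Fin N) ℝ).symm.toContinuousLinearMap ∘L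
          ContinuousLinearMap.pi fun i =>
            (ContinuousLinearMap.proj t) ∘L (ContinuousLinearMap.proj i)
    exact h3.map L

end BrownianMotion

/-! ### Euler scheme and Gaussianity of the linear equation -/

section Euler

variable {E : Type*} [NormedAddCommGroup E] [NormedSpace ℝ E]

/-- The explicit Euler scheme with mesh `h` for the linear equation `dw = db + F w dt`,
`w 0 = w₀ + b 0`. -/
noncomputable def eulerScheme (F : ℝ → E →L[ℝ] E) (w₀ : E) (b : ℝ → E) (h : ℝ) : ℕ → E
  | 0 => w₀ + b 0
  | k + 1 => eulerScheme F w₀ b h k + (b ((k + 1 : ℕ) * h) - b (k * h)) +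
      h • F (k * h) (eulerScheme F w₀ b h k)

/-- The Euler scheme is an affine function of finitely many values of the driving path. -/
lemma exists_eulerScheme_eq (F : ℝ → E →L[ℝ] E) (w₀ : E) (h : ℝ) (k : ℕ) :
    ∃ (c : E) (M : ℕ → E →L[ℝ] E), ∀ b : ℝ → E,
      eulerScheme F w₀ b h k = c + ∑ j ∈ Finset.range (k + 1), M j (b (j * h)) := by
  induction k with
  | zero => exact ⟨w₀, fun _ => .id ℝ E, fun b => by simp [eulerScheme]⟩
  | succ k ih =>
    obtain ⟨c, M, hM⟩ := ih
    -- One step transports the old coefficients by `S`; the increment of `b` adds the identity at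
    -- node `k + 1` and subtracts it at node `k`.
    let S : E →L[ℝ] E := .id ℝ E + h • F (k * h)
    refine ⟨S c, fun j => if j = k + 1 then .id ℝ E else S ∘L M j -
      (if j = k then .id ℝ E else 0), fun b => ?_⟩
    have e : ∑ j ∈ Finset.range (k + 1), (if j = k + 1 then ContinuousLinearMap.id ℝ E else
        S ∘L M j - (if j = k then .id ℝ E else 0)) (b (j * h)) =
        S (∑ j ∈ Finset.range (k + 1), M j (b (j * h))) - b (k * h) := by
      have : ∀ j ∈ Finset.range (k + 1), (if j = k + 1 then ContinuousLinearMap.id ℝ E else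
          S ∘L M j - (if j = k then .id ℝ E else 0)) (b (j * h)) =
          S (M j (b (j * h))) - if j = k then b (k * h) else 0 := fun j hj => by
        rw [if_neg (Finset.mem_range.1 hj).ne]
        by_cases hjk : j = k
        · subst hjk; simp
        · simp [hjk]
      rw [Finset.sum_congr rfl this, Finset.sum_sub_distrib, map_sum]
      simp
    rw [Finset.sum_range_succ, e, eulerScheme, hM b]
    simp only [if_true, S, add_apply, smul_apply,
      ContinuousLinearMap.id_apply, map_add, smul_add]
    abel

variable [CompleteSpace E]

/-- Discrete Grönwall: each step multiplies the error by at most `1 + K h ≤ exp (K h)` and adds at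
most `ε h`. The noise increments are exact and cancel. -/
lemma norm_eulerScheme_sub_le {F : ℝ → E →L[ℝ] E} {w₀ : E} {b w : ℝ → E} {T K ε h : ℝ} {n : ℕ}
    (hK : 0 ≤ K) (hε : 0 ≤ ε) (hh : 0 ≤ h) (hn : n * h = T)
    (hF : ContinuousOn F (Icc 0 T)) (hFK : ∀ s ∈ Icc 0 T, ‖F s‖ ≤ K)
    (hw : ContinuousOn w (Icc 0 T))
    (heq : ∀ s ∈ Icc 0 T, w s = w₀ + b s + ∫ r in (0 : ℝ)..s, F r (w r))
    (hosc : ∀ s ∈ Icc 0 T, ∀ r ∈ Icc 0 T, |s - r| ≤ h → ‖F s (w s) - F r (w r)‖ ≤ ε) :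
    ∀ k ≤ n, ‖eulerScheme F w₀ b h k - w (k * h)‖ ≤ ε * (k * h) * Real.exp (K * (k * h)) := by
  have hT : 0 ≤ T := hn ▸ by positivity
  have hc : ContinuousOn (fun r => F r (w r)) (Icc 0 T) := hF.clm_apply hw
  have hmem : ∀ k ≤ n, (k : ℝ) * h ∈ Icc 0 T := fun k hk =>
    ⟨by positivity, hn ▸ mul_le_mul_of_nonneg_right (by exact_mod_cast hk) hh⟩
  intro k
  induction k with
  | zero =>
    intro _
    have := heq 0 ⟨le_rfl, hT⟩
    simp only [intervalIntegral.integral_same, add_zero] at this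
    simp [eulerScheme, this]
  | succ k ih =>
    intro hk
    have ih := ih (by omega)
    set a : ℝ := k * h with ha
    have ha' : ((k + 1 : ℕ) : ℝ) * h = a + h := by push_cast; ring
    have hma := hmem k (by omega)
    have hmb := hmem (k + 1) hk
    rw [ha'] at hmb ⊢
    rw [← ha] at hma
    have hii : ∀ s ∈ Icc 0 T, IntervalIntegrable (fun r => F r (w r)) volume 0 s := fun s hs =>
      ContinuousOn.intervalIntegrable
        (hc.mono (by rw [uIcc_of_le hs.1]; exact Icc_subset_Icc_right hs.2))
    have hdiff : w (a + h) - w a =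
        (b (a + h) - b a) + h • F a (w a) + ∫ r in a..a + h, (F r (w r) - F a (w a)) := by
      rw [intervalIntegral.integral_sub ((hii _ hma).symm.trans (hii _ hmb)) (by simp),
        intervalIntegral.integral_const, add_sub_cancel_left,
        ← intervalIntegral.integral_interval_sub_left (hii _ hmb) (hii _ hma),
        heq _ hma, heq _ hmb]
      abel
    have hrem : ‖∫ r in a..a + h, (F r (w r) - F a (w a))‖ ≤ ε * h := by
      have := intervalIntegral.norm_integral_le_of_norm_le_const (a := a) (b := a + h) (C := ε)
        (f := fun r => F r (w r) - F a (w a)) fun r hr => by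
          rw [uIoc_of_le (by linarith)] at hr
          exact hosc r ⟨hma.1.trans hr.1.le, hr.2.trans hmb.2⟩ a hma
            (by rw [abs_of_pos (by linarith [hr.1])]; linarith [hr.2])
      simpa [abs_of_nonneg hh] using this
    have hstep : eulerScheme F w₀ b h (k + 1) - w (a + h) =
        (eulerScheme F w₀ b h k - w a) + h • F a (eulerScheme F w₀ b h k - w a) -
          ∫ r in a..a + h, (F r (w r) - F a (w a)) := by
      rw [eulerScheme, ha', ← ha, map_sub, smul_sub,
        show w (a + h) = w a + (w (a + h) - w a) by abel, hdiff]
      abel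
    have hFe : ‖h • F a (eulerScheme F w₀ b h k - w a)‖ ≤
        h * (K * ‖eulerScheme F w₀ b h k - w a‖) := by
      rw [norm_smul, Real.norm_eq_abs, abs_of_nonneg hh]
      exact mul_le_mul_of_nonneg_left ((F a).le_of_opNorm_le (hFK a hma) _) hh
    have hexp1 : 1 + K * h ≤ Real.exp (K * h) := by
      linarith [Real.add_one_le_exp (K * h)]
    have hexp2 : 1 ≤ Real.exp (K * (a + h)) :=
      Real.one_le_exp (mul_nonneg hK hmb.1)
    calc ‖eulerScheme F w₀ b h (k + 1) - w (a + h)‖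
        ≤ ‖eulerScheme F w₀ b h k - w a‖ + h * (K * ‖eulerScheme F w₀ b h k - w a‖) + ε * h := by
          rw [hstep]
          exact (norm_sub_le _ _).trans
            (add_le_add ((norm_add_le _ _).trans (add_le_add le_rfl hFe)) hrem)
      _ = (1 + K * h) * ‖eulerScheme F w₀ b h k - w a‖ + ε * h := by ring
      _ ≤ Real.exp (K * h) * (ε * a * Real.exp (K * a)) + ε * h * Real.exp (K * (a + h)) := by
          refine add_le_add (mul_le_mul hexp1 ih (norm_nonneg _) (Real.exp_pos _).le) ?_
          exact le_mul_of_one_le_right (by positivity) hexp2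
      _ = ε * (a + h) * Real.exp (K * (a + h)) := by rw [mul_add K, Real.exp_add]; ring

/-- The Euler scheme converges. -/
lemma tendsto_eulerScheme {F : ℝ → E →L[ℝ] E} {w₀ : E} {b w : ℝ → E} {T : ℝ} (hT : 0 ≤ T)
    (hF : ContinuousOn F (Icc 0 T)) (hw : ContinuousOn w (Icc 0 T))
    (heq : ∀ s ∈ Icc 0 T, w s = w₀ + b s + ∫ r in (0 : ℝ)..s, F r (w r)) :
    Tendsto (fun n : ℕ => eulerScheme F w₀ b (T / n) n) atTop (𝓝 (w T)) := by
  obtain ⟨K, hFK⟩ := isCompact_Icc.exists_bound_of_continuousOn hF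
  have hK : 0 ≤ K := (norm_nonneg _).trans (hFK 0 ⟨le_rfl, hT⟩)
  have huc := isCompact_Icc.uniformContinuousOn_of_continuous (hF.clm_apply hw)
  rw [Metric.uniformContinuousOn_iff_le] at huc
  rw [Metric.tendsto_atTop]
  intro η hη
  set D : ℝ := T * Real.exp (K * T) with hD
  have hD0 : 0 ≤ D := by positivity
  obtain ⟨δ, hδ, hosc⟩ := huc (η / (D + 1)) (by positivity)
  obtain ⟨n₀, hn₀⟩ := exists_nat_gt (T / δ)
  refine ⟨max n₀ 1, fun n hn => ?_⟩
  have hn1 : 1 ≤ n := (le_max_right _ _).trans hn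
  have hnpos : (0 : ℝ) < n := by exact_mod_cast hn1
  have hmesh : T / n ≤ δ := by
    have h1 : (n₀ : ℝ) ≤ n := by exact_mod_cast (le_max_left _ _).trans hn
    rw [div_le_iff₀ hnpos]
    rw [div_lt_iff₀ hδ] at hn₀
    nlinarith
  have hnT : (n : ℝ) * (T / n) = T := by field_simp
  have := norm_eulerScheme_sub_le (ε := η / (D + 1)) hK (by positivity)
    (by positivity : 0 ≤ T / (n : ℝ)) hnT hF hFK hw heq
    (fun s hs r hr hsr => by
      have := hosc s hs r hr (by rw [Real.dist_eq]; exact hsr.trans hmesh)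
      rwa [dist_eq_norm] at this) n le_rfl
  rw [hnT] at this
  rw [dist_eq_norm]
  calc _ ≤ η / (D + 1) * T * Real.exp (K * T) := this
    _ = η * (D / (D + 1)) := by rw [hD]; ring
    _ < η * 1 := by
        refine mul_lt_mul_of_pos_left ?_ hη
        rw [div_lt_one (by positivity)]; linarith
    _ = η := mul_one η

variable [MeasurableSpace E] [BorelSpace E] [SecondCountableTopology E]
  {Ω : Type*} [MeasurableSpace Ω] {P : Measure Ω}

/-- The solution of a linear equation driven by a Gaussian process is a Gaussian process. -/
lemma isGaussianProcess_of_linear_integral_eq {F : ℝ → E →L[ℝ] E} {w₀ : E} {B W : ℝ → Ω → E}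
    (hB : IsGaussianProcess (fun (t : ℝ≥0) ω => B t ω) P) (hF : ContinuousOn F (Ici 0))
    (hW : ∀ᵐ ω ∂P, ContinuousOn (fun t => W t ω) (Ici 0) ∧ ∀ t, 0 ≤ t →
      W t ω = w₀ + B t ω + ∫ r in (0 : ℝ)..t, F r (W r ω)) :
    IsGaussianProcess (fun (t : ℝ≥0) ω => W t ω) P := by
  refine IsGaussianProcess.of_ae_tendsto
    -- The mesh may depend on `t`, since only convergence at each fixed time is needed. For `n = 0`
    -- the scheme takes no step and is just `w₀ + B 0`.
    (Z := fun n (t : ℝ≥0) ω => eulerScheme F w₀ (fun s => B s ω) ((t : ℝ) / n) n)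
    (fun n => ?_) fun t => ?_
  · choose c M hM using fun t : ℝ≥0 => exists_eulerScheme_eq F w₀ ((t : ℝ) / n) n
    simp_rw [hM]
    refine IsGaussianProcess.const_add (hB.of_isGaussianProcess
      (Y := fun t ω => ∑ j ∈ Finset.range (n + 1), M t j (B (j * ((t : ℝ) / n)) ω))
      fun t => ?_) c
    classical
    let I : Finset ℝ≥0 := (Finset.range (n + 1)).image fun j : ℕ => j * (t / n)
    refine ⟨I, ∑ j : Finset.range (n + 1), M t j ∘L
      ContinuousLinearMap.proj ⟨(j : ℕ) * (t / n), Finset.mem_image_of_mem _ j.2⟩, fun ω => ?_⟩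
    rw [sum_apply, ← Finset.sum_coe_sort]
    refine Finset.sum_congr rfl fun j _ => ?_
    simp
  · filter_upwards [hW] with ω hω
    exact tendsto_eulerScheme t.2 (hF.mono Icc_subset_Ici_self)
      (hω.1.mono Icc_subset_Ici_self) fun s hs => hω.2 s hs.1

end Euler

/-! ### Measurable bound of the driving path -/

section RandomBound

variable {N : ℕ} {Ω : Type*} [MeasurableSpace Ω] {P : Measure Ω}
  {B : ℝ → Ω → EuclideanSpace ℝ (Fin N)}

lemma IsBrownianMotion.ae_continuousOn (hB : IsBrownianMotion B P) :
    ∀ᵐ ω ∂P, ContinuousOn (fun t => B t ω) (Ici 0) := by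
  have : ∀ᵐ ω ∂P, ∀ i, Continuous fun t : ℝ≥0 => B t ω i :=
    ae_all_iff.2 fun i => (hB.isBrownianReal i).cont
  filter_upwards [this] with ω hω
  have hc : Continuous fun t : ℝ => (WithLp.toLp 2 fun i => B t.toNNReal ω i :
      EuclideanSpace ℝ (Fin N)) :=
    (PiLp.continuous_toLp 2 _).comp
      (continuous_pi fun i => (hω i).comp continuous_real_toNNReal)
  refine hc.continuousOn.congr fun t ht => ?_
  ext i
  simp [Real.coe_toNNReal t ht]

/-- A continuous process is bounded on compact time intervals by a measurable integer. -/
lemma exists_measurable_nat_bound {E : Type*} [NormedAddCommGroup E] [MeasurableSpace E]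
    [BorelSpace E] {B : ℝ → Ω → E} (hm : ∀ t, 0 ≤ t → AEMeasurable (B t) P)
    (hc : ∀ᵐ ω ∂P, ContinuousOn (fun t => B t ω) (Ici 0)) {T : ℝ} (hT : 0 ≤ T) :
    ∃ n : Ω → ℕ, Measurable n ∧ ∀ᵐ ω ∂P, ∀ s ∈ Icc 0 T, ‖B s ω‖ ≤ n ω := by
  -- Clamping to `[0, T]` lets the supremum run over all of `ℚ`, endpoints included; countability
  -- gives measurability and continuity recovers every time.
  let u : ℝ → ℝ := fun q => max 0 (min T q)
  have hu : Continuous u := by fun_prop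
  have hu0 : ∀ q, u q ∈ Icc 0 T := fun q => ⟨le_max_left _ _, max_le hT (min_le_left _ _)⟩
  have hmu : ∀ q : ℚ, AEMeasurable (B (u q)) P := fun q => hm _ (hu0 q).1
  let f : Ω → ENNReal := fun ω => ⨆ q : ℚ, ‖(hmu q).mk _ ω‖ₑ
  have hf : Measurable f := Measurable.iSup fun q => (hmu q).measurable_mk.enorm
  refine ⟨fun ω => ⌈(f ω).toReal⌉₊, Nat.measurable_ceil.comp hf.ennreal_toReal, ?_⟩
  filter_upwards [hc, ae_all_iff.2 fun q => (hmu q).ae_eq_mk] with ω hω hmk s hs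
  have hfe : f ω = ⨆ q : ℚ, ‖B (u q) ω‖ₑ := by simp only [f, hmk]
  have hωu : Continuous fun q => B (u q) ω :=
    hω.comp_continuous hu fun q => (hu0 q).1
  obtain ⟨M, hM⟩ := isCompact_Icc.exists_bound_of_continuousOn (hω.mono Icc_subset_Ici_self)
  have hfin : f ω ≠ ⊤ := by
    rw [hfe]
    refine ne_top_of_le_ne_top ENNReal.ofReal_ne_top (iSup_le fun q => ?_ : _ ≤ ENNReal.ofReal M)
    rw [← ofReal_norm]
    exact ENNReal.ofReal_le_ofReal (hM _ (hu0 q))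
  have hq : ∀ q : ℝ, ‖B (u q) ω‖ ≤ (f ω).toReal := fun q => by
    refine Rat.denseRange_cast.induction_on q (isClosed_le hωu.norm continuous_const) fun q => ?_
    rw [← toReal_enorm]
    refine ENNReal.toReal_mono hfin ?_
    rw [hfe]
    exact le_iSup (fun q : ℚ => ‖B (u q) ω‖ₑ) q
  have hus : u s = s := by simp only [u]; rw [min_eq_right hs.2, max_eq_right hs.1]
  have := hq s
  rw [hus] at this
  exact this.trans (Nat.le_ceil _)

end RandomBound

theorem theorem3p2 {N : ℕ} {Ω : Type*} [MeasurableSpace Ω] (P : Measure Ω) [IsProbabilityMeasure P]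
    (B : ℝ → Ω → EuclideanSpace ℝ (Fin N)) (hB : IsBrownianMotion B P)
    (ν : ℝ) (hν : 0 < ν)
    (x y : EuclideanSpace ℝ (Fin N)) (hx : x ∈ interior (weylChamberB N))
    (β₀ : ℝ) (hβ₀ : 1 / 2 ≤ β₀)
    (hstart : ∀ β, β₀ ≤ β → √β • x + y ∈ interior (weylChamberB N))
    (φ : ℝ → EuclideanSpace ℝ (Fin N)) (hφ : IsLimitFlowB ν x φ)
    (W : ℝ → Ω → EuclideanSpace ℝ (Fin N))
    (hW : ∀ᵐ ω ∂P, IsLimitPathB ν φ y (fun t => B t ω) (fun t => W t ω))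
    (X : ℝ → ℝ → Ω → EuclideanSpace ℝ (Fin N))
    (hX : ∀ β, β₀ ≤ β → ∀ᵐ ω ∂P,
      IsBesselPathB (ν * β) β (√β • x + y) (fun t => B t ω) (fun t => X β t ω)) :
    -- the limit process is Gaussian
    IsGaussianProcess (fun (t : ℝ≥0) ω => W t ω) P ∧
    -- one finite random variable bounds the scaled error for all `β ≥ β₀` and all `s ≤ t`
    (∀ t : ℝ, 0 < t → ∃ C : Ω → ℝ, Measurable C ∧ ∀ β, β₀ ≤ β → ∀ᵐ ω ∂P, ∀ s ∈ Icc 0 t,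
      √β * ‖X β s ω - √β • φ s - W s ω‖ ≤ C ω) ∧
    -- if the exceptional null set of the equations does not depend on `β`, then
    -- neither does that of the estimate
    ((∀ᵐ ω ∂P, ∀ β, β₀ ≤ β →
        IsBesselPathB (ν * β) β (√β • x + y) (fun t => B t ω) (fun t => X β t ω)) →
      (∀ t : ℝ, 0 < t → ∀ᵐ ω ∂P,
        BddAbove {r : ℝ | ∃ s ∈ Icc 0 t, ∃ β, β₀ ≤ β ∧
          r = √β * ‖X β s ω - √β • φ s - W s ω‖}) ∧
      (∀ᵐ ω ∂P, ∀ t : ℝ, 0 < t →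
        TendstoUniformlyOn (fun β s => X β s ω - √β • φ s) (fun s => W s ω) atTop (Icc 0 t) ∧
        ∃ C : ℝ, ∀ᶠ β in atTop, ∀ s ∈ Icc 0 t,
          ‖(X β s ω - √β • φ s) - W s ω‖ ≤ C / √β)) := by
  have hν0 := hν.le
  have hβpos : 0 < β₀ := by linarith
  refine ⟨isGaussianProcess_of_linear_integral_eq hB.isGaussianProcess hφ.continuousOn_operator
    (hW.mono fun ω hω => ⟨hω.continuousOn, hω.eq_integral⟩), fun t ht => ?_, fun hX' => ?_⟩
  · obtain ⟨n, hn, hnB⟩ := exists_measurable_nat_bound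
      (fun t ht => hB.isGaussianProcess.aemeasurable ⟨t, ht⟩) hB.ae_continuousOn ht.le
    -- Choosing a constant for each integer bound makes `c ∘ n` measurable for free, as every
    -- function on `ℕ` is measurable.
    choose c hc using fun R : ℕ => exists_scaled_error_bound hν0 hφ hβpos y ht.le (R : ℝ)
    refine ⟨fun ω => c (n ω), (measurable_from_top (f := c)).comp hn, fun β hβ => ?_⟩
    filter_upwards [hW, hX β hβ, hnB] with ω hWω hXω hBω
    exact hc (n ω) _ _ hWω hBω β hβ _ hXω
  · have key : ∀ᵐ ω ∂P, ∀ t : ℝ, 0 < t → ∃ C : ℝ, ∀ β, β₀ ≤ β → ∀ s ∈ Icc 0 t,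
        √β * ‖X β s ω - √β • φ s - W s ω‖ ≤ C := by
      filter_upwards [hW, hX', hB.ae_continuousOn] with ω hWω hXω hBω t ht
      obtain ⟨R, hR⟩ := isCompact_Icc.exists_bound_of_continuousOn (hBω.mono Icc_subset_Ici_self)
      obtain ⟨C, hC⟩ := exists_scaled_error_bound hν0 hφ hβpos y ht.le R
      exact ⟨C, fun β hβ => hC _ _ hWω hR β hβ _ (hXω β hβ)⟩
    refine ⟨fun t ht => ?_, ?_⟩
    · filter_upwards [key] with ω hω
      obtain ⟨C, hC⟩ := hω t ht
      refine ⟨C, ?_⟩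
      rintro r ⟨s, hs, β, hβ, rfl⟩
      exact hC β hβ s hs
    · filter_upwards [key] with ω hω t ht
      obtain ⟨C, hC⟩ := hω t ht
      have hev : ∀ᶠ β in atTop, ∀ s ∈ Icc 0 t,
          ‖(X β s ω - √β • φ s) - W s ω‖ ≤ C / √β := by
        filter_upwards [eventually_ge_atTop β₀] with β hβ s hs
        rw [le_div_iff₀ (Real.sqrt_pos.2 (hβpos.trans_le hβ)), mul_comm]
        exact hC β hβ s hs
      refine ⟨?_, C, hev⟩
      rw [Metric.tendstoUniformlyOn_iff]
      intro ε hε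
      have hlim : Tendsto (fun β : ℝ => C / √β) atTop (𝓝 0) :=
        tendsto_const_nhds.div_atTop Real.tendsto_sqrt_atTop
      filter_upwards [hev, hlim.eventually (gt_mem_nhds hε)] with β hβ hβε s hs
      rw [dist_comm, dist_eq_norm]
      exact (hβ s hs).trans_lt hβε
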